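/- Let $L^2$ be the space of square-integrable functions on the unit circle $\mathbb T$ with normalized Lebesgue measure, and let $H^2\subset L^2$ be the Hardy space of the unit disk $\mathbb D$, identified with a subspace of $L^2$ via boundary values. Let $\theta$ be an inner function, that is, $\theta\in H^2$ and $|\theta|=1$ almost everywhere on $\mathbb T$. Let $K_\theta=H^2\ominus\theta H^2$, let $P_\theta$ be the orthogonal projection from $L^2$ onto $K_\theta$, and let $S_\theta: K_\theta\to K_\theta$, $S_\theta f=P_\theta(zf)$. For $\lambda\in\mathbb D$ let $$k_\lambda=\frac{1-\overline{\theta(\lambda)}\,\theta}{1-\bar\lambda z}\in K_\theta$$ be the reproducing kernel of $K_\theta$ at $\lambda$, and let $\bar\partial^{\,n}k_0\in K_\theta$ be the value at $\lambda=0$ of the $n$-th derivative of $k_\lambda$ with respect to $\bar\lambda$, taken in the norm of $K_\theta$ (with $\bar\partial^{\,0}k_0=k_0$). Let $A$ be a bounded truncated Toeplitz operator on $K_\theta$, that is, a bounded linear operator on $K_\theta$ for which there is $\phi\in L^2$ with $Af=P_\theta(\phi f)$ for all $f\in K_\theta\cap L^\infty$. Let $\overline{\operatorname{Ran}A}$ be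 the closure of its range, and assume that $\overline{\operatorname{Ran}A}\neq K_\theta$. Then there is a largest integer $n\ge 0$ such that $\bar\partial^{\,j}k_0\in\overline{\operatorname{Ran}A}$ for all $0\le j<n$, and for this $n$ the sum of $\overline{\operatorname{Ran}A}$ and the linear span $\langle\bar\partial^{\,n}k_0\rangle$ is direct and $$S_\theta\,\overline{\operatorname{Ran}A}\subset\overline{\operatorname{Ran}A}\dotplus\langle\bar\partial^{\,n}k_0\rangle .$$ -/

import Mathlib

noncomputable section

open MeasureTheory AddCircle Filter
open scoped ENNReal ComplexConjugate InnerProductSpace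

namespace TruncatedToeplitz

/-- The space `L²` on the unit circle. The circle is parametrized by `UnitAddCircle = ℝ/ℤ`, the
independent variable is `z = fourier 1`, that is `x ↦ exp(2πix)`, and the measure is normalized
Lebesgue measure. -/
abbrev L2 : Type := Lp ℂ 2 (haarAddCircle : Measure UnitAddCircle)

/-- The Hardy space `H²`, as the subspace of `L²` of all functions whose Fourier coefficients of
negative index vanish. -/
def H2 : Submodule ℂ L2 where
  carrier := {f | ∀ n : ℤ, n < 0 → fourierCoeff (f : UnitAddCircle → ℂ) n = 0}
  zero_mem' n _ := by
    rw [← fourierBasis_repr]; simp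
  add_mem' {f g} hf hg n hn := by
    have h1 := hf n hn
    have h2 := hg n hn
    rw [← fourierBasis_repr] at h1 h2 ⊢
    simp [h1, h2]
  smul_mem' c f hf n hn := by
    have h1 := hf n hn
    rw [← fourierBasis_repr] at h1 ⊢
    simp [h1]

theorem isClosed_H2 : IsClosed (H2 : Set L2) := by
  have : (H2 : Set L2) = ⋂ n : ℤ, ⋂ _ : n < 0,
      {f : L2 | ⟪fourierBasis (T := 1) n, f⟫_ℂ = 0} := by
    ext f
    simp only [Set.mem_iInter, Set.mem_ofPred_eq]
    refine forall₂_congr fun n _ => ?_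
    rw [← fourierBasis.repr_apply_apply f n, fourierBasis_repr]
  rw [this]
  exact isClosed_iInter fun n => isClosed_iInter fun _ =>
    isClosed_eq (continuous_const.inner continuous_id) continuous_const

/-- The value at a point `w` of the unit disk of the analytic function `∑ aₙ zⁿ` with boundary
function `f ∈ H²`. -/
def diskValue (f : L2) (w : ℂ) : ℂ :=
  ∑' n : ℕ, fourierCoeff (f : UnitAddCircle → ℂ) (n : ℤ) * w ^ n

/-- Inner functions: functions in `H²` that are unimodular almost everywhere on the circle. -/
structure IsInner (θ : L2) : Prop where
  mem_H2 : θ ∈ H2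
  norm_eq_one : ∀ᵐ x ∂(haarAddCircle : Measure UnitAddCircle), ‖θ x‖ = 1

/-- The subspace `θ H²`. -/
def thetaH2 (θ : L2) : Submodule ℂ L2 where
  carrier := {h | ∃ g ∈ H2, h =ᵐ[haarAddCircle] fun x => θ x * g x}
  zero_mem' := ⟨0, H2.zero_mem, by
    filter_upwards [Lp.coeFn_zero ℂ 2 (haarAddCircle : Measure UnitAddCircle)] with x hx
    rw [hx]; simp⟩
  add_mem' := by
    rintro h₁ h₂ ⟨g₁, hg₁, e₁⟩ ⟨g₂, hg₂, e₂⟩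
    refine ⟨g₁ + g₂, H2.add_mem hg₁ hg₂, ?_⟩
    filter_upwards [e₁, e₂, Lp.coeFn_add h₁ h₂, Lp.coeFn_add g₁ g₂] with x a b c d
    rw [c, d, Pi.add_apply, Pi.add_apply, a, b, mul_add]
  smul_mem' := by
    rintro c h ⟨g, hg, e⟩
    refine ⟨c • g, H2.smul_mem c hg, ?_⟩
    filter_upwards [e, Lp.coeFn_smul c h, Lp.coeFn_smul c g] with x a b d
    rw [b, d, Pi.smul_apply, Pi.smul_apply, a, smul_eq_mul, smul_eq_mul]; ring

/-- The model space `K_θ = H² ⊖ θ H²`. -/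
def K (θ : L2) : Submodule ℂ L2 := H2 ⊓ (thetaH2 θ)ᗮ

instance (θ : L2) : CompleteSpace (K θ) :=
  (isClosed_H2.inter (thetaH2 θ).isClosed_orthogonal).completeSpace_coe

/-- The orthogonal projection `P_θ` from `L²` onto `K_θ`. -/
def P (θ : L2) : L2 →L[ℂ] K θ := (K θ).orthogonalProjectionOnto

/-- Multiplication by the independent variable `z` on `L²`. -/
def Mz : L2 →L[ℂ] L2 :=
  (ContinuousLinearMap.mul ℂ ℂ).holderL haarAddCircle ∞ 2 2 (fourierLp ∞ 1)

/-- The restricted shift `S_θ f = P_θ (z f)`. -/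
def S (θ : L2) : K θ →L[ℂ] K θ := P θ ∘L Mz ∘L (K θ).subtypeL

/-- `A` is a bounded truncated Toeplitz operator on `K_θ`: there is a symbol `φ ∈ L²` such that
`A f = P_θ (φ f)` for all `f ∈ K_θ ∩ L^∞`. -/
def IsTruncatedToeplitz (θ : L2) (A : K θ →L[ℂ] K θ) : Prop :=
  ∃ φ : L2, ∀ (f : K θ) (hf : MemLp (f : L2) ∞ haarAddCircle),
    A f = P θ ((hf.mul' (Lp.memLp φ) : MemLp (fun x => φ x * (f : L2) x) 2 haarAddCircle).toLp)

/-- The function `(1 - conj θ(w) θ) / (1 - conj w z)` on the circle. -/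
def kernelFun (θ : L2) (w : ℂ) (x : UnitAddCircle) : ℂ :=
  (1 - conj (diskValue θ w) * θ x) / (1 - conj w * fourier 1 x)

theorem norm_fourier_apply (n : ℤ) (x : UnitAddCircle) : ‖(fourier n x : ℂ)‖ = 1 := by
  rw [fourier_apply]
  exact Circle.norm_coe _

theorem norm_conj_mul_fourier_lt {w : ℂ} (hw : ‖w‖ < 1) (x : UnitAddCircle) :
    ‖conj w * fourier 1 x‖ < 1 := by
  rw [norm_mul, norm_fourier_apply, mul_one, RCLike.norm_conj]
  exact hw

theorem continuous_inv_kernel {w : ℂ} (hw : ‖w‖ < 1) :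
    Continuous fun x : UnitAddCircle => (1 - conj w * fourier 1 x)⁻¹ := by
  refine Continuous.inv₀ (by fun_prop) fun x h => ?_
  have h1 := norm_conj_mul_fourier_lt hw x
  rw [← sub_eq_zero.mp h] at h1
  simp at h1

theorem memLp_kernelFun (θ : L2) {w : ℂ} (hw : ‖w‖ < 1) :
    MemLp (kernelFun θ w) 2 (haarAddCircle : Measure UnitAddCircle) := by
  have h1 : MemLp (fun x : UnitAddCircle => (1 - conj w * fourier 1 x)⁻¹) ∞ haarAddCircle :=
    BoundedContinuousFunction.memLp_top
      (BoundedContinuousFunction.mkOfCompact ⟨_, continuous_inv_kernel hw⟩)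
  have h2 : MemLp (fun x => 1 - conj (diskValue θ w) * θ x) 2
      (haarAddCircle : Measure UnitAddCircle) :=
    (memLp_const 1).sub ((Lp.memLp θ).const_mul _)
  exact h1.mul' h2

theorem hasSum_integral_div (F : UnitAddCircle → ℂ) (hF : Integrable F haarAddCircle) {w : ℂ}
    (hw : ‖w‖ < 1) :
    HasSum (fun m : ℕ => conj w ^ m * ∫ x, fourier (m : ℤ) x * F x ∂haarAddCircle)
      (∫ x, F x / (1 - conj w * fourier 1 x) ∂haarAddCircle) := by
  have hint : ∀ m : ℕ, Integrable (fun x => (conj w * fourier 1 x) ^ m * F x)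
      (haarAddCircle : Measure UnitAddCircle) := fun m =>
    hF.bdd_mul (c := 1) (by fun_prop) (Eventually.of_forall fun x => by
      rw [norm_pow]
      exact pow_le_one₀ (norm_nonneg _) (norm_conj_mul_fourier_lt hw x).le)
  have key := hasSum_integral_of_summable_integral_norm hint (by
    have : ∀ m : ℕ, ∫ x, ‖(conj w * fourier 1 x) ^ m * F x‖ ∂haarAddCircle
        = ‖w‖ ^ m * ∫ x, ‖F x‖ ∂haarAddCircle := fun m => by
      rw [← integral_const_mul]
      congr 1; ext x
      rw [norm_mul, norm_pow, norm_mul, norm_fourier_apply, mul_one, RCLike.norm_conj]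
    simp_rw [this]
    exact (summable_geometric_of_lt_one (norm_nonneg _) hw).mul_right _)
  have e1 : (fun m : ℕ => conj w ^ m * ∫ x, fourier (m : ℤ) x * F x ∂haarAddCircle)
      = fun m : ℕ => ∫ x, (conj w * fourier 1 x) ^ m * F x ∂haarAddCircle := by
    ext m
    rw [← integral_const_mul]
    congr 1; ext x
    have : (fourier (m : ℤ) x : ℂ) = (fourier 1 x) ^ m := by
      simp [fourier_apply, toCircle_nsmul]
    rw [this, mul_pow]; ring
  have e2 : ∫ x, F x / (1 - conj w * fourier 1 x) ∂haarAddCircle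
      = ∫ x, ∑' m : ℕ, (conj w * fourier 1 x) ^ m * F x ∂haarAddCircle := by
    congr 1; ext x
    rw [tsum_mul_right, tsum_geometric_of_norm_lt_one (norm_conj_mul_fourier_lt hw x)]
    rw [div_eq_mul_inv, mul_comm]
  rw [e1, e2]
  exact key

theorem integral_fourier_mul (m i : ℤ) (f : UnitAddCircle → ℂ) :
    ∫ x, fourier m x * (fourier (-i) x * f x) ∂haarAddCircle = fourierCoeff f (i - m) := by
  rw [fourierCoeff]
  congr 1; ext x
  rw [← mul_assoc, ← fourier_add, smul_eq_mul, neg_sub, sub_eq_add_neg]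

theorem fourierCoeff_conj (f : UnitAddCircle → ℂ) (n : ℤ) :
    fourierCoeff (fun x => conj (f x)) n = conj (fourierCoeff f (-n)) := by
  rw [fourierCoeff, fourierCoeff, ← integral_conj]
  congr 1; ext x
  simp

theorem fourierCoeff_one (n : ℤ) :
    fourierCoeff (fun _ : UnitAddCircle => (1 : ℂ)) n = if n = 0 then 1 else 0 := by
  have h := congrFun (fourierCoeff_fourier (T := 1) 0) n
  rw [Pi.single_apply] at h
  rw [← h]
  congr 1; ext x
  simp

theorem norm_fourierCoeff_le (f : L2) (n : ℤ) :
    ‖fourierCoeff (f : UnitAddCircle → ℂ) n‖ ≤ ‖f‖ := by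
  rw [← fourierBasis_repr, fourierBasis.repr_apply_apply]
  refine (norm_inner_le_norm _ _).trans ?_
  rw [fourierBasis.orthonormal.norm_eq_one, one_mul]

theorem hasSum_diskValue (f : L2) {w : ℂ} (hw : ‖w‖ < 1) :
    HasSum (fun n : ℕ => fourierCoeff (f : UnitAddCircle → ℂ) (n : ℤ) * w ^ n) (diskValue f w) := by
  refine Summable.hasSum (Summable.of_norm_bounded
    ((summable_geometric_of_lt_one (norm_nonneg w) hw).mul_left ‖f‖) fun n => ?_)
  rw [norm_mul, norm_pow]
  gcongr
  exact norm_fourierCoeff_le f n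

theorem kernel_mem {θ : L2} (hθ : IsInner θ) {w : ℂ} (hw : ‖w‖ < 1) :
    (memLp_kernelFun θ hw).toLp ∈ K θ := by
  have hθi : Integrable θ haarAddCircle := (Lp.memLp θ).integrable (by norm_num)
  have hθc : Integrable (fun x => conj (θ x)) (haarAddCircle : Measure UnitAddCircle) :=
    (Complex.conjLIE.toContinuousLinearEquiv.toContinuousLinearMap).integrable_comp hθi
  have hf : ∀ (i : ℤ) (F : UnitAddCircle → ℂ), Integrable F haarAddCircle →
      Integrable (fun x => fourier i x * F x) haarAddCircle := fun i F hF =>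
    hF.bdd_mul (c := 1) (by fun_prop) (Eventually.of_forall fun x =>
      (norm_fourier_apply i x).le)
  have hco := (memLp_kernelFun θ hw).coeFn_toLp
  refine ⟨fun n hn => ?_, ?_⟩
  · have h1 : fourierCoeff ((memLp_kernelFun θ hw).toLp : UnitAddCircle → ℂ) n
        = ∫ x, (fourier (-n) x * (1 - conj (diskValue θ w) * θ x))
          / (1 - conj w * fourier 1 x) ∂haarAddCircle := by
      rw [fourierCoeff]
      refine integral_congr_ae ?_
      filter_upwards [hco] with x hx
      rw [hx, kernelFun, smul_eq_mul, mul_div_assoc]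
    have hi : Integrable (fun x => 1 - conj (diskValue θ w) * θ x)
        (haarAddCircle : Measure UnitAddCircle) :=
      (integrable_const _).sub (hθi.const_mul _)
    have h2 := hasSum_integral_div _ (hf (-n) _ hi) hw
    rw [h1]
    refine h2.unique ?_
    convert hasSum_zero using 2 with m
    rw [integral_fourier_mul]
    have : fourierCoeff (fun x => 1 - conj (diskValue θ w) * θ x) (n - m)
        = fourierCoeff (fun _ : UnitAddCircle => (1 : ℂ)) (n - m)
          - conj (diskValue θ w) * fourierCoeff θ (n - m) := by
      simp only [fourierCoeff, smul_eq_mul]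
      rw [← integral_const_mul, ← integral_sub (hf _ _ (integrable_const _))
        ((hf _ _ hθi).const_mul _)]
      congr 1; ext x; ring
    rw [this, fourierCoeff_one, if_neg (by omega), hθ.mem_H2 _ (by omega)]
    simp
  · refine (Submodule.mem_orthogonal _ _).2 ?_
    rintro h ⟨g, hg, e⟩
    have hb : MemLp (fun x => conj (θ x)) ∞ (haarAddCircle : Measure UnitAddCircle) :=
      memLp_top_of_bound hθc.1 1 (by
        filter_upwards [hθ.norm_eq_one] with x hx
        simp [hx])
    have hv : MemLp (fun x => conj (θ x) * kernelFun θ w x) 2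
        (haarAddCircle : Measure UnitAddCircle) := (memLp_kernelFun θ hw).mul' hb
    have hin : ⟪h, (memLp_kernelFun θ hw).toLp⟫_ℂ = ⟪g, hv.toLp⟫_ℂ := by
      rw [MeasureTheory.L2.inner_def, MeasureTheory.L2.inner_def]
      refine integral_congr_ae ?_
      filter_upwards [hco, hv.coeFn_toLp, e] with x h1 h2 h3
      rw [h1, h2, h3]
      simp; ring
    rw [hin]
    refine (fourierBasis.hasSum_inner_mul_inner g hv.toLp).unique ?_
    convert hasSum_zero using 2 with i
    rcases lt_or_ge i 0 with hi | hi
    · rw [← inner_conj_symm, ← fourierBasis.repr_apply_apply g i, fourierBasis_repr, hg i hi]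
      simp
    · rw [← fourierBasis.repr_apply_apply hv.toLp i, fourierBasis_repr]
      obtain ⟨i, rfl⟩ := Int.eq_ofNat_of_zero_le hi
      have h1 : fourierCoeff (hv.toLp : UnitAddCircle → ℂ) (i : ℤ)
          = ∫ x, (fourier (-(i : ℤ)) x * (conj (θ x) - conj (diskValue θ w)))
            / (1 - conj w * fourier 1 x) ∂haarAddCircle := by
        rw [fourierCoeff]
        refine integral_congr_ae ?_
        filter_upwards [hv.coeFn_toLp, hθ.norm_eq_one] with x hx h1
        have h2 : conj (θ x) * θ x = 1 := by
          rw [Complex.conj_mul', h1]; simp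
        rw [hx, kernelFun, smul_eq_mul, mul_div_assoc, ← mul_div_assoc (conj (θ x))]
        congr 2
        linear_combination -conj (diskValue θ w) * h2
      have hi : Integrable (fun x => conj (θ x) - conj (diskValue θ w))
          (haarAddCircle : Measure UnitAddCircle) := hθc.sub (integrable_const _)
      have h2 := hasSum_integral_div _ (hf (-(i : ℤ)) _ hi) hw
      suffices fourierCoeff (hv.toLp : UnitAddCircle → ℂ) (i : ℤ) = 0 by rw [this, mul_zero]
      rw [h1]
      refine h2.unique ?_
      have h3 : ∀ m : ℕ, conj w ^ m * ∫ x, fourier (m : ℤ) x *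
          (fourier (-(i : ℤ)) x * (conj (θ x) - conj (diskValue θ w))) ∂haarAddCircle
          = conj w ^ m * conj (fourierCoeff θ ((m : ℤ) - i))
            - if m = i then conj w ^ i * conj (diskValue θ w) else 0 := by
        intro m
        rw [integral_fourier_mul]
        have : fourierCoeff (fun x => conj (θ x) - conj (diskValue θ w)) ((i : ℤ) - m)
            = fourierCoeff (fun x => conj (θ x)) ((i : ℤ) - m)
              - conj (diskValue θ w)
                * fourierCoeff (fun _ : UnitAddCircle => (1 : ℂ)) ((i : ℤ) - m) := by
          simp only [fourierCoeff, smul_eq_mul]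
          rw [← integral_const_mul, ← integral_sub (hf _ _ hθc)
            ((hf _ _ (integrable_const _)).const_mul _)]
          congr 1; ext x; ring
        rw [this, fourierCoeff_conj, fourierCoeff_one, neg_sub]
        by_cases hm : m = i
        · subst hm; simp; ring
        · rw [if_neg (by omega), if_neg hm]; ring
      have h5 : HasSum (fun m : ℕ => conj w ^ m * conj (fourierCoeff θ ((m : ℤ) - i)))
          (conj w ^ i * conj (diskValue θ w)) := by
        rw [← (add_left_injective i).hasSum_iff]
        · have h4 := ((hasSum_diskValue θ hw).map (starRingEnd ℂ)
            Complex.continuous_conj).mul_left (conj w ^ i)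
          have e4 : (fun m : ℕ => conj w ^ m * conj (fourierCoeff θ ((m : ℤ) - i))) ∘ (· + i)
              = fun n : ℕ => conj w ^ i *
                (starRingEnd ℂ ∘ fun n : ℕ => fourierCoeff θ (n : ℤ) * w ^ n) n := by
            ext n
            simp [pow_add]; ring
          rw [e4]
          exact h4
        · intro m hm
          have : m < i := by
            by_contra hc
            exact hm ⟨m - i, by simp; omega⟩
          rw [hθ.mem_H2 _ (by omega)]
          simp
      have h6 := h5.sub (hasSum_ite_eq i (conj w ^ i * conj (diskValue θ w)))
      rw [sub_self] at h6
      rw [funext h3]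
      exact h6

/-- The reproducing kernel `k_w` of `K_θ` at a point `w` of the open unit disk; outside the disk
the value `0` is a placeholder. -/
def kernel {θ : L2} (hθ : IsInner θ) (w : ℂ) : K θ :=
  if hw : ‖w‖ < 1 then ⟨(memLp_kernelFun θ hw).toLp, kernel_mem hθ hw⟩ else 0

/-- The derivative of order `n` of the map `w ↦ k_w` with respect to `conj w`, in the norm of
`K_θ`, that is the complex derivative of order `n` of `u ↦ k_{conj u}` at `u = conj w`. -/
def dbarKernel {θ : L2} (hθ : IsInner θ) (n : ℕ) (w : ℂ) : K θ :=
  iteratedDeriv n (fun u : ℂ => kernel hθ (conj u)) (conj w)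

/-- The closure in `K_θ` of the range of an operator on `K_θ`. -/
def closureRange {θ : L2} (A : K θ →L[ℂ] K θ) : Submodule ℂ (K θ) :=
  A.range.topologicalClosure

end TruncatedToeplitz

end

open TruncatedToeplitz

/-!
Let `C f = θ conj (z f)` be the conjugation of `K_θ` and let `B` be the adjoint of `S_θ`, that is
`B f = (f - f 0) / z`. For a truncated Toeplitz operator `A` with symbol `φ` the bilinear form
`β(p, q) = ⟪A C p, q⟫` is `∫ conj (φ θ) z p q` on bounded functions, which are dense in `K_θ`. It
depends on the product `p q` only, so it is a Hankel form: it is symmetric, and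
`β(B p, q) = β(p, B q)` when `p` and `q` vanish at `0`. Its kernel is `(Ran A)ᗮ`.

Since `∂̄ʲ k_0 = j! S_θʲ k_0` evaluates the `j`-th Taylor coefficient up to the factor `j!`, the
number `n` of the theorem is the smallest order of vanishing at `0` on the kernel of `β`, and the
inclusion is dual to the assertion that `B` maps the functions of order greater than `n` in the
kernel of `β` back into it. Let `f` be such a function and `h` a function of order `n` in the
kernel. If `q` vanishes at `0`, then `β(B f, q) = β(f, B q) = 0`; moreover
`β(B f, Bⁿ h) = β(Bⁿ⁺¹ f, h) = 0`, and `Bⁿ h` does not vanish at `0`, so `B f` pairs to zero with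
everything.
-/

noncomputable section

open MeasureTheory AddCircle Filter
open scoped ENNReal ComplexConjugate InnerProductSpace Topology InnerProduct

namespace TruncatedToeplitz

theorem exists_isGreatest_forall_lt {p : ℕ → Prop} (h : ∃ n, ¬p n) :
    ∃ n, IsGreatest {m | ∀ j < m, p j} n ∧ ¬p n := by
  classical
  exact ⟨Nat.find h, ⟨fun j hj => not_not.1 (Nat.find_min h hj),
    fun m hm => not_lt.1 fun hlt => Nat.find_spec h (hm _ hlt)⟩, Nat.find_spec h⟩

section HankelForm

variable {𝕜 V : Type*} [Field 𝕜] [AddCommGroup V] [Module 𝕜 V]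

/-- A Hankel form: a symmetric bilinear form on a space `V` of functions for which
`β (p / z) q = β p (q / z)` whenever `p` and `q` vanish at the origin. Evaluation at the origin is
encoded by the linear form `ev` and `f ↦ (f - f 0) / z` by the linear map `B`. -/
structure IsHankelForm (β : LinearMap.BilinForm 𝕜 V) (ev : V →ₗ[𝕜] 𝕜) (B : Module.End 𝕜 V) :
    Prop where
  symm : ∀ p q, β p q = β q p
  shift : ∀ p q, ev p = 0 → ev q = 0 → β (B p) q = β p (B q)

variable {β : LinearMap.BilinForm 𝕜 V} {ev : V →ₗ[𝕜] 𝕜} {B : Module.End 𝕜 V}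

theorem IsHankelForm.pow_shift (hβ : IsHankelForm β ev B) {n : ℕ} {p q : V}
    (hp : ∀ j < n, ev ((B ^ j) p) = 0) (hq : ∀ j < n, ev ((B ^ j) q) = 0) :
    β ((B ^ n) p) q = β p ((B ^ n) q) := by
  induction n generalizing q with
  | zero => rfl
  | succ n ih =>
    have hq' : ∀ j < n, ev ((B ^ j) (B q)) = 0 := fun j hj => by
      rw [← Module.End.mul_apply, ← pow_succ]
      exact hq (j + 1) (Nat.succ_lt_succ hj)
    calc β ((B ^ (n + 1)) p) q
        = β (B ((B ^ n) p)) q := by rw [pow_succ', Module.End.mul_apply]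
      _ = β ((B ^ n) p) (B q) := hβ.shift _ _ (hp n n.lt_succ_self) (hq 0 n.succ_pos)
      _ = β p ((B ^ n) (B q)) := ih (fun j hj => hp j (hj.trans n.lt_succ_self)) hq'
      _ = β p ((B ^ (n + 1)) q) := by rw [pow_succ, Module.End.mul_apply]

/-- With `f` of order greater than `n` at the origin and `h` of order exactly `n`, the form pairs
`f / z` to zero both with functions vanishing at the origin and with `h / zⁿ`, and these span. -/
theorem IsHankelForm.shift_mem_ker (hβ : IsHankelForm β ev B) {n : ℕ} {f h : V}
    (hf : f ∈ LinearMap.ker β) (hh : h ∈ LinearMap.ker β) (hf0 : ∀ j ≤ n, ev ((B ^ j) f) = 0)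
    (hh0 : ∀ j < n, ev ((B ^ j) h) = 0) (hhn : ev ((B ^ n) h) ≠ 0) :
    B f ∈ LinearMap.ker β := by
  rw [LinearMap.mem_ker] at hf hh ⊢
  have vanishing : LinearMap.ker ev ≤ LinearMap.ker (β (B f)) := fun w hw =>
    (hβ.shift f w (hf0 0 n.zero_le) hw).trans (by rw [hf, LinearMap.zero_apply])
  have quotient : Submodule.span 𝕜 {(B ^ n) h} ≤ LinearMap.ker (β (B f)) := by
    rw [Submodule.span_singleton_le_iff_mem, LinearMap.mem_ker, hβ.symm,
      hβ.pow_shift hh0 fun j hj => ?_, hh, LinearMap.zero_apply]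
    rw [← Module.End.mul_apply, ← pow_succ]
    exact hf0 (j + 1) hj
  rw [← LinearMap.ker_eq_top, ← top_le_iff, ← ev.span_singleton_sup_ker_eq_top hhn]
  exact sup_le quotient vanishing

end HankelForm

section Hilbert

variable {𝕜 E : Type*} [RCLike 𝕜] [NormedAddCommGroup E] [InnerProductSpace 𝕜 E] [CompleteSpace E]

theorem map_le_sup_span_of_adjoint_mem {T : E →L[𝕜] E} {R : Submodule 𝕜 E}
    (hR : IsClosed (R : Set E)) {v : E} (h : ∀ f ∈ Rᗮ, ⟪v, f⟫_𝕜 = 0 → (T†) f ∈ Rᗮ) :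
    R.map (T : E →ₗ[𝕜] E) ≤ R ⊔ Submodule.span 𝕜 {v} := by
  have hclosed : IsClosed ((R ⊔ Submodule.span 𝕜 {v} : Submodule 𝕜 E) : Set E) :=
    Submodule.isClosed_sup_finiteDimensional _ _ hR
  rw [← hclosed.submodule_topologicalClosure_eq, ← Submodule.orthogonal_orthogonal_eq_closure]
  rintro _ ⟨x, hx, rfl⟩
  refine (Submodule.mem_orthogonal _ _).2 fun f hf => ?_
  rw [← Submodule.inf_orthogonal, Submodule.mem_inf,
    Submodule.mem_orthogonal_singleton_iff_inner_right] at hf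
  rw [ContinuousLinearMap.coe_coe, ← ContinuousLinearMap.adjoint_inner_left]
  exact Submodule.inner_left_of_mem_orthogonal hx (h f hf.1 hf.2)

theorem mem_iff_forall_orthogonal {R : Submodule 𝕜 E} (hR : IsClosed (R : Set E)) {v : E} :
    v ∈ R ↔ ∀ f ∈ Rᗮ, ⟪v, f⟫_𝕜 = 0 := by
  rw [← Submodule.mem_orthogonal', Submodule.orthogonal_orthogonal_eq_closure,
    hR.submodule_topologicalClosure_eq]

end Hilbert

theorem eventually_summable_pow_smul_pow_apply {𝕜 F : Type*} [NontriviallyNormedField 𝕜]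
    [NormedAddCommGroup F] [NormedSpace 𝕜 F] [CompleteSpace F] (T : F →L[𝕜] F) (x : F) :
    ∀ᶠ u : 𝕜 in 𝓝 0, Summable fun n : ℕ => u ^ n • (T ^ n) x := by
  have hsmall : ∀ᶠ u : 𝕜 in 𝓝 0, ‖u • T‖ < 1 :=
    ((continuous_id.smul continuous_const).norm.tendsto' 0 0 (by simp)).eventually_lt_const one_pos
  filter_upwards [hsmall] with u hu
  simpa only [smul_pow, ContinuousLinearMap.apply_apply, smul_apply] using
    (summable_geometric_of_norm_lt_one hu).mapL (ContinuousLinearMap.apply 𝕜 F x)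

theorem iteratedDeriv_zero_eq_of_hasSum {𝕜 F : Type*} [NontriviallyNormedField 𝕜]
    [NormedAddCommGroup F] [NormedSpace 𝕜 F] [CompleteSpace F] {g : 𝕜 → F} {a : ℕ → F}
    (h : ∀ᶠ u in 𝓝 0, HasSum (fun n => u ^ n • a n) (g u)) (n : ℕ) :
    iteratedDeriv n g 0 = (n.factorial : 𝕜) • a n := by
  let p : FormalMultilinearSeries 𝕜 𝕜 F := fun n => .mkPiRing 𝕜 (Fin n) (a n)
  have hp : p.coeff = a := by
    ext n
    simp [p, FormalMultilinearSeries.coeff]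
  obtain ⟨r, hr⟩ : HasFPowerSeriesAt g p 0 := by simpa only [hasFPowerSeriesAt_iff, hp, zero_add]
  rw [iteratedDeriv_eq_iteratedFDeriv, ← hr.factorial_smul 1 n, ← hp, Nat.cast_smul_eq_nsmul]
  rfl

theorem fourierCoeff_fourier_mul {T : ℝ} [Fact (0 < T)] (f : AddCircle T → ℂ) (m n : ℤ) :
    fourierCoeff (fun x => fourier m x * f x) n = fourierCoeff f (n - m) := by
  simp only [fourierCoeff, smul_eq_mul, ← mul_assoc, ← fourier_add, sub_eq_add_neg, neg_add_rev,
    neg_neg]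
  simp only [add_comm]

section Multiplication

variable {α : Type*} [MeasurableSpace α] {μ : Measure α} {u v : α → ℂ}

/-- Multiplication by a bounded function `u`, as an operator on `L²(μ)`. -/
def mulBounded (hu : MemLp u ∞ μ) : Lp ℂ 2 μ →L[ℂ] Lp ℂ 2 μ :=
  (ContinuousLinearMap.mul ℂ ℂ).holderL μ ∞ 2 2 hu.toLp

theorem coeFn_mulBounded (hu : MemLp u ∞ μ) (f : Lp ℂ 2 μ) :
    mulBounded hu f =ᵐ[μ] fun x => u x * f x := by
  filter_upwards [(ContinuousLinearMap.mul ℂ ℂ).coeFn_holder (r := 2) hu.toLp f, hu.coeFn_toLp]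
    with x hmul hux
  rw [← hux]
  exact hmul

theorem mulBounded_comm (hu : MemLp u ∞ μ) (hv : MemLp v ∞ μ) (f : Lp ℂ 2 μ) :
    mulBounded hu (mulBounded hv f) = mulBounded hv (mulBounded hu f) := by
  refine Lp.ext ?_
  filter_upwards [coeFn_mulBounded hu (mulBounded hv f), coeFn_mulBounded hv (mulBounded hu f),
    coeFn_mulBounded hu f, coeFn_mulBounded hv f] with x huv hvu hux hvx
  rw [huv, hvu, hux, hvx, mul_left_comm]

theorem mulBounded_coe_comm {f g : Lp ℂ 2 μ} (hf : MemLp f ∞ μ) (hg : MemLp g ∞ μ) :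
    mulBounded hf g = mulBounded hg f := by
  refine Lp.ext ?_
  filter_upwards [coeFn_mulBounded hf g, coeFn_mulBounded hg f] with x hfx hgx
  rw [hfx, hgx, mul_comm]

theorem coeFn_adjoint_mulBounded (hu : MemLp u ∞ μ) (f : Lp ℂ 2 μ) :
    ((mulBounded hu)†) f =ᵐ[μ] fun x => conj (u x) * f x := by
  have hadj : ((mulBounded hu)†) f = mulBounded hu.star f := by
    refine ext_inner_left ℂ fun g => ?_
    rw [ContinuousLinearMap.adjoint_inner_right, L2.inner_def, L2.inner_def]
    refine integral_congr_ae ?_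
    filter_upwards [coeFn_mulBounded hu g, coeFn_mulBounded hu.star f] with x hgx hfx
    rw [hgx, hfx]
    simp only [RCLike.inner_apply, map_mul, Pi.star_apply, RCLike.star_def]
    ring
  rw [hadj]
  exact coeFn_mulBounded hu.star f

end Multiplication

theorem memLp_top_fourier (n : ℤ) :
    MemLp (fun x : UnitAddCircle => (fourier n x : ℂ)) ∞ haarAddCircle :=
  memLp_top_of_bound (fourier n).continuous.aestronglyMeasurable 1
    (Eventually.of_forall fun x => (norm_fourier_apply n x).le)

theorem Mz_eq_mulBounded : Mz = mulBounded (memLp_top_fourier 1) := rfl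

theorem coeFn_Mz (f : L2) : Mz f =ᵐ[haarAddCircle] fun x => fourier 1 x * f x :=
  coeFn_mulBounded (memLp_top_fourier 1) f

theorem fourierCoeff_Mz (f : L2) (n : ℤ) : fourierCoeff (Mz f) n = fourierCoeff f (n - 1) := by
  rw [fourierCoeff_congr_ae (coeFn_Mz f), fourierCoeff_fourier_mul]

theorem inner_fourierLp (f : L2) (n : ℤ) : ⟪(fourierLp 2 n : L2), f⟫_ℂ = fourierCoeff f n := by
  rw [← fourierBasis_repr, fourierBasis.repr_apply_apply, coe_fourierBasis]

theorem fourierCoeff_fourierLp (m n : ℤ) :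
    fourierCoeff (fourierLp 2 m : L2) n = if n = m then 1 else 0 := by
  rw [fourierCoeff_congr_ae (coeFn_fourierLp 2 m), fourierCoeff_fourier, Pi.single_apply]

theorem ext_fourierCoeff {f g : L2} (h : ∀ n, fourierCoeff f n = fourierCoeff g n) : f = g :=
  fourierBasis.repr.injective <| lp.ext <| funext fun n => by
    rw [fourierBasis_repr, fourierBasis_repr, h]

theorem fourierCoeff_L2_sub (f g : L2) (n : ℤ) :
    fourierCoeff (f - g : L2) n = fourierCoeff f n - fourierCoeff g n := by
  simp only [← inner_fourierLp, inner_sub_right]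

theorem fourierCoeff_L2_smul (c : ℂ) (f : L2) (n : ℤ) :
    fourierCoeff (c • f : L2) n = c * fourierCoeff f n := by
  simp only [← inner_fourierLp, inner_smul_right]

theorem Mz_fourierLp (n : ℤ) : Mz (fourierLp 2 n) = fourierLp 2 (n + 1) :=
  ext_fourierCoeff fun m => by
    simp only [fourierCoeff_Mz, fourierCoeff_fourierLp, sub_eq_iff_eq_add]

theorem Mz_adjoint_Mz (f : L2) : Mz ((Mz†) f) = f := by
  refine Lp.ext ?_
  filter_upwards [coeFn_Mz ((Mz†) f), coeFn_adjoint_mulBounded (memLp_top_fourier 1) f]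
    with x hx hadj
  rw [hx, Mz_eq_mulBounded, hadj, ← mul_assoc, Complex.mul_conj', norm_fourier_apply]
  simp

theorem fourierCoeff_adjoint_Mz (f : L2) (n : ℤ) :
    fourierCoeff ((Mz†) f) n = fourierCoeff f (n + 1) := by
  rw [← inner_fourierLp, ContinuousLinearMap.adjoint_inner_right, Mz_fourierLp, inner_fourierLp]

theorem inner_eq_zero_of_fourierCoeff {f g : L2}
    (h : ∀ n, fourierCoeff f n = 0 ∨ fourierCoeff g n = 0) : ⟪f, g⟫_ℂ = 0 := by
  refine (fourierBasis.hasSum_inner_mul_inner f g).unique ?_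
  convert hasSum_zero using 2 with n
  rw [coe_fourierBasis, ← inner_conj_symm f, inner_fourierLp, inner_fourierLp]
  rcases h n with h | h <;> simp [h]

theorem fourierLp_mem_H2 (n : ℕ) : (fourierLp 2 (n : ℤ) : L2) ∈ H2 := fun m hm => by
  rw [fourierCoeff_fourierLp, if_neg (by omega)]

theorem eq_zero_of_mem_H2 {f : L2} (hf : f ∈ H2) (h : ∀ n : ℕ, fourierCoeff f n = 0) : f = 0 :=
  (inner_self_eq_zero (𝕜 := ℂ)).1 <| inner_eq_zero_of_fourierCoeff fun n => Or.inl <| by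
    rcases n with n | n
    · exact h n
    · exact hf _ (Int.negSucc_lt_zero n)

/-- The inner product that `K θ` inherits from `L2`, preferred to the one coming from the
`C⋆`-module structure, which is not syntactically the one in Mathlib's lemmas on inner products. -/
local instance (θ : L2) : Inner ℂ (K θ) := InnerProductSpace.toInner

section InnerFunction

variable {θ : L2} (hθ : IsInner θ)
include hθ

theorem IsInner.memLp_top : MemLp θ ∞ haarAddCircle :=
  memLp_top_of_bound (Lp.aestronglyMeasurable _) 1 (hθ.norm_eq_one.mono fun _ hx => hx.le)

theorem IsInner.mem_thetaH2_iff {h : L2} :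
    h ∈ thetaH2 θ ↔ ∃ g ∈ H2, mulBounded hθ.memLp_top g = h := by
  refine exists_congr fun g => and_congr_right fun _ => ⟨fun h => Lp.ext ?_, fun h => ?_⟩
  · exact (coeFn_mulBounded hθ.memLp_top g).trans h.symm
  · exact h ▸ coeFn_mulBounded hθ.memLp_top g

theorem IsInner.mem_K_iff {f : L2} :
    f ∈ K θ ↔ f ∈ H2 ∧ ∀ n : ℕ, fourierCoeff (((mulBounded hθ.memLp_top)†) f) n = 0 := by
  refine and_congr_right fun _ => (Submodule.mem_orthogonal _ _).trans ⟨fun h n => ?_, ?_⟩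
  · rw [← inner_fourierLp, ContinuousLinearMap.adjoint_inner_right]
    exact h _ (hθ.mem_thetaH2_iff.2 ⟨_, fourierLp_mem_H2 n, rfl⟩)
  · intro h u hu
    obtain ⟨g, hg, rfl⟩ := hθ.mem_thetaH2_iff.1 hu
    rw [← ContinuousLinearMap.adjoint_inner_right]
    refine inner_eq_zero_of_fourierCoeff fun n => ?_
    rcases n with n | n
    · exact Or.inr (h n)
    · exact Or.inl (hg _ (Int.negSucc_lt_zero n))

end InnerFunction

section BackwardShift

variable {θ : L2}

theorem fourierCoeff_adjoint_mulBounded_fourierLp (hθ : IsInner θ) (m n : ℤ) :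
    fourierCoeff (((mulBounded hθ.memLp_top)†) (fourierLp 2 m)) n =
      conj (fourierCoeff θ (m - n)) := by
  have hae : ((mulBounded hθ.memLp_top)†) (fourierLp 2 m) =ᵐ[haarAddCircle]
      fun x => fourier m x * conj (θ x) := by
    filter_upwards [coeFn_adjoint_mulBounded hθ.memLp_top (fourierLp 2 m), coeFn_fourierLp 2 m]
      with x hadj hm
    rw [hadj, hm, mul_comm]
  rw [fourierCoeff_congr_ae hae, fourierCoeff_fourier_mul, fourierCoeff_conj, neg_sub]

theorem adjoint_Mz_sub_mem_K (hθ : IsInner θ) (f : K θ) :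
    (Mz†) ((f : L2) - fourierCoeff (f : L2) 0 • fourierLp 2 0) ∈ K θ := by
  refine hθ.mem_K_iff.2 ⟨fun n hn => ?_, fun n => ?_⟩
  · rw [fourierCoeff_adjoint_Mz, fourierCoeff_L2_sub, fourierCoeff_L2_smul, fourierCoeff_fourierLp]
    rcases eq_or_ne (n + 1) 0 with h | h
    · rw [h, if_pos rfl, mul_one, sub_self]
    · rw [if_neg h, mul_zero, sub_zero, f.2.1 _ (by omega)]
  · rw [← inner_fourierLp, ContinuousLinearMap.adjoint_inner_right,
      ContinuousLinearMap.adjoint_inner_right, Mz_eq_mulBounded, mulBounded_comm _ hθ.memLp_top,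
      ← Mz_eq_mulBounded, Mz_fourierLp, ← ContinuousLinearMap.adjoint_inner_right,
      inner_fourierLp, map_sub, map_smul, fourierCoeff_L2_sub, fourierCoeff_L2_smul,
      fourierCoeff_adjoint_mulBounded_fourierLp hθ, ← Nat.cast_add_one,
      (hθ.mem_K_iff.1 f.2).2 (n + 1), hθ.mem_H2 _ (by omega), map_zero, mul_zero, sub_zero]

theorem coe_adjoint_S (hθ : IsInner θ) (f : K θ) :
    (((S θ)†) f : L2) = (Mz†) ((f : L2) - fourierCoeff (f : L2) 0 • fourierLp 2 0) := by
  suffices ((S θ)†) f = ⟨_, adjoint_Mz_sub_mem_K hθ f⟩ from congrArg Subtype.val this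
  refine ext_inner_left ℂ fun g => ?_
  have hg : ⟪Mz (g : L2), fourierLp 2 0⟫_ℂ = 0 := by
    rw [← inner_conj_symm, inner_fourierLp, fourierCoeff_Mz, g.2.1 _ (by norm_num), map_zero]
  rw [ContinuousLinearMap.adjoint_inner_right, Submodule.coe_inner _ g,
    ContinuousLinearMap.adjoint_inner_right, inner_sub_right, inner_smul_right, hg, mul_zero,
    sub_zero]
  exact Submodule.inner_orthogonalProjectionOnto_eq_of_mem_right f (Mz (g : L2))

theorem Mz_adjoint_S (hθ : IsInner θ) (f : K θ) :
    Mz (((S θ)†) f : L2) = (f : L2) - fourierCoeff (f : L2) 0 • fourierLp 2 0 := by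
  rw [coe_adjoint_S hθ, Mz_adjoint_Mz]

theorem fourierCoeff_adjoint_S (hθ : IsInner θ) (f : K θ) (n : ℕ) :
    fourierCoeff (((S θ)†) f : L2) n = fourierCoeff (f : L2) (n + 1 : ℕ) := by
  rw [coe_adjoint_S hθ, fourierCoeff_adjoint_Mz, fourierCoeff_L2_sub, fourierCoeff_L2_smul,
    fourierCoeff_fourierLp, if_neg (by omega), mul_zero, sub_zero, Nat.cast_add_one]

end BackwardShift

section Conjugation

/-- The antilinear map `f ↦ conj (z f)` of `L²`, which exchanges the Fourier coefficients of index
`n` and `-n - 1`. -/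
def conjMz : L2 →L⋆[ℂ] L2 :=
  (((starL ℂ : ℂ ≃L⋆[ℂ] ℂ) : ℂ →L⋆[ℂ] ℂ).compLpL 2 haarAddCircle).comp Mz

theorem coeFn_conjMz (f : L2) : conjMz f =ᵐ[haarAddCircle] fun x => conj (fourier 1 x * f x) := by
  filter_upwards [coeFn_Mz f, ContinuousLinearMap.coeFn_compLpL
    ((starL ℂ : ℂ ≃L⋆[ℂ] ℂ) : ℂ →L⋆[ℂ] ℂ) (Mz f)] with x hx hstar
  rw [← hx]
  exact hstar

theorem fourierCoeff_conjMz (f : L2) (n : ℤ) :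
    fourierCoeff (conjMz f) n = conj (fourierCoeff f (-n - 1)) := by
  rw [fourierCoeff_congr_ae (coeFn_conjMz f), fourierCoeff_conj, fourierCoeff_fourier_mul]

theorem conjMz_conjMz (f : L2) : conjMz (conjMz f) = f :=
  ext_fourierCoeff fun n => by
    rw [fourierCoeff_conjMz, fourierCoeff_conjMz, Complex.conj_conj, neg_sub, sub_neg_eq_add,
      add_sub_cancel_left]

variable {θ : L2} (hθ : IsInner θ)

theorem mulBounded_conjMz (f : L2) :
    mulBounded hθ.memLp_top (conjMz f) = conjMz (((mulBounded hθ.memLp_top)†) f) := by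
  refine Lp.ext ?_
  filter_upwards [coeFn_mulBounded hθ.memLp_top (conjMz f), coeFn_conjMz f,
    coeFn_conjMz (((mulBounded hθ.memLp_top)†) f), coeFn_adjoint_mulBounded hθ.memLp_top f]
    with x hmul hconj hconj' hadj
  rw [hmul, hconj, hconj', hadj, mul_left_comm, map_mul _ (conj (θ x)), Complex.conj_conj]

theorem adjoint_mulBounded_mulBounded (f : L2) :
    ((mulBounded hθ.memLp_top)†) (mulBounded hθ.memLp_top f) = f := by
  refine Lp.ext ?_
  filter_upwards [coeFn_adjoint_mulBounded hθ.memLp_top (mulBounded hθ.memLp_top f),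
    coeFn_mulBounded hθ.memLp_top f, hθ.norm_eq_one] with x hadj hmul hx
  rw [hadj, hmul, ← mul_assoc, Complex.conj_mul', hx]
  simp

theorem mulBounded_conjMz_mem_K {f : L2} (hf : f ∈ K θ) :
    mulBounded hθ.memLp_top (conjMz f) ∈ K θ := by
  refine hθ.mem_K_iff.2 ⟨fun n hn => ?_, fun n => ?_⟩
  · obtain ⟨m, hm⟩ := Int.eq_ofNat_of_zero_le (show 0 ≤ -n - 1 by omega)
    rw [mulBounded_conjMz hθ, fourierCoeff_conjMz, hm, (hθ.mem_K_iff.1 hf).2, map_zero]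
  · rw [adjoint_mulBounded_mulBounded hθ, fourierCoeff_conjMz, hf.1 _ (by omega), map_zero]

/-- The conjugation `f ↦ θ conj (z f)` of the model space `K θ`. -/
def modelConj : K θ →L⋆[ℂ] K θ :=
  (((mulBounded hθ.memLp_top).comp conjMz).comp (K θ).subtypeL).codRestrict (K θ)
    fun f => mulBounded_conjMz_mem_K hθ f.2

theorem coeFn_modelConj (f : K θ) :
    (modelConj hθ f : L2) =ᵐ[haarAddCircle] fun x => θ x * conj (fourier 1 x * (f : L2) x) := by
  filter_upwards [coeFn_mulBounded hθ.memLp_top (conjMz f), coeFn_conjMz f] with x hmul hconj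
  rw [← hconj]
  exact hmul

theorem modelConj_modelConj (f : K θ) : modelConj hθ (modelConj hθ f) = f :=
  Subtype.ext <| calc mulBounded hθ.memLp_top (conjMz (mulBounded hθ.memLp_top (conjMz f)))
    _ = conjMz (conjMz f) := by rw [mulBounded_conjMz hθ, adjoint_mulBounded_mulBounded hθ]
    _ = f := conjMz_conjMz f

theorem memLp_top_modelConj {f : K θ} (hf : MemLp (f : L2) ∞ haarAddCircle) :
    MemLp (modelConj hθ f : L2) ∞ haarAddCircle := by
  refine hf.congr_norm (Lp.aestronglyMeasurable _) ?_
  filter_upwards [coeFn_modelConj hθ f, hθ.norm_eq_one] with x hfx hx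
  rw [hfx, norm_mul, hx, RCLike.norm_conj, norm_mul, norm_fourier_apply, one_mul, one_mul]

end Conjugation

section Kernel

variable {θ : L2} (hθ : IsInner θ)

theorem inner_kernel (f : K θ) {w : ℂ} (hw : ‖w‖ < 1) :
    ⟪kernel hθ w, f⟫_ℂ = diskValue (f : L2) w := by
  set g : L2 := f - diskValue θ w • ((mulBounded hθ.memLp_top)†) (f : L2)
  have hg (m : ℕ) : fourierCoeff g m = fourierCoeff (f : L2) m := by
    rw [fourierCoeff_L2_sub, fourierCoeff_L2_smul, (hθ.mem_K_iff.1 f.2).2, mul_zero, sub_zero]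
  have hgi : Integrable (fun x => conj (g x)) haarAddCircle :=
    Complex.conjCLE.toContinuousLinearMap.integrable_comp ((Lp.memLp g).integrable (by norm_num))
  have hsum := hasSum_integral_div _ hgi hw
  have hint : ∫ x, conj (g x) / (1 - conj w * fourier 1 x) ∂haarAddCircle =
      ⟪f, kernel hθ w⟫_ℂ := by
    rw [Submodule.coe_inner, L2.inner_def, kernel, dif_pos hw]
    refine integral_congr_ae ?_
    filter_upwards [Lp.coeFn_sub (f : L2) (diskValue θ w • ((mulBounded hθ.memLp_top)†) (f : L2)),
      Lp.coeFn_smul (diskValue θ w) (((mulBounded hθ.memLp_top)†) (f : L2)),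
      coeFn_adjoint_mulBounded hθ.memLp_top (f : L2), (memLp_kernelFun θ hw).coeFn_toLp]
      with x hsub hsmul hadj hk
    rw [hsub, Pi.sub_apply, hsmul, Pi.smul_apply, hadj, hk, kernelFun, RCLike.inner_apply,
      smul_eq_mul]
    simp only [map_sub, map_mul, Complex.conj_conj]
    ring
  have hval : ⟪f, kernel hθ w⟫_ℂ = conj (diskValue (f : L2) w) := by
    rw [← hint]
    refine hsum.unique ?_
    convert (hasSum_diskValue (f : L2) hw).map (starRingEnd ℂ) Complex.continuous_conj using 2
      with m
    have hm : ∫ x, fourier (m : ℤ) x * conj (g x) ∂haarAddCircle = conj (fourierCoeff g m) := by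
      simpa [fourierCoeff_conj] using integral_fourier_mul m 0 fun x => conj (g x)
    rw [hm, hg, Function.comp_apply, map_mul, map_pow, mul_comm]
  rw [← inner_conj_symm, hval, Complex.conj_conj]

theorem inner_kernel_zero (f : K θ) : ⟪kernel hθ 0, f⟫_ℂ = fourierCoeff (f : L2) 0 := by
  rw [inner_kernel hθ f (by simp), diskValue, tsum_eq_single 0 fun n hn => by simp [hn]]
  simp

theorem inner_pow_S_kernel_zero (f : K θ) (n : ℕ) :
    ⟪(S θ ^ n) (kernel hθ 0), f⟫_ℂ = fourierCoeff (f : L2) n := by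
  induction n generalizing f with
  | zero => exact inner_kernel_zero hθ f
  | succ n ih =>
    rw [pow_succ', mul_apply_eq_comp, ← ContinuousLinearMap.adjoint_inner_right, ih,
      fourierCoeff_adjoint_S hθ]

theorem eventually_hasSum_pow_smul_pow_S_kernel_zero :
    ∀ᶠ u : ℂ in 𝓝 0,
      HasSum (fun n => u ^ n • (S θ ^ n) (kernel hθ 0)) (kernel hθ (conj u)) := by
  filter_upwards [eventually_summable_pow_smul_pow_apply (S θ) (kernel hθ 0),
    Metric.ball_mem_nhds (0 : ℂ) one_pos] with u hsum hu
  rw [mem_ball_zero_iff, ← RCLike.norm_conj] at hu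
  suffices kernel hθ (conj u) = ∑' n, u ^ n • (S θ ^ n) (kernel hθ 0) by
    rw [this]
    exact hsum.hasSum
  refine ext_inner_right ℂ fun f => ?_
  rw [inner_kernel hθ f hu]
  refine (hasSum_diskValue (f : L2) hu).unique ?_
  have hinner := hsum.hasSum.mapL (innerSLFlip ℂ f)
  simp only [innerSLFlip_apply_apply, inner_smul_left, inner_pow_S_kernel_zero, map_pow] at hinner
  simpa only [mul_comm] using hinner

theorem dbarKernel_zero (n : ℕ) :
    dbarKernel hθ n 0 = (n.factorial : ℂ) • (S θ ^ n) (kernel hθ 0) := by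
  rw [dbarKernel, map_zero]
  exact iteratedDeriv_zero_eq_of_hasSum (eventually_hasSum_pow_smul_pow_S_kernel_zero hθ) n

/-- The subspace `K_θ ∩ L^∞` of `K_θ`. -/
def boundedPart (θ : L2) : Submodule ℂ (K θ) where
  carrier := {f | MemLp (f : L2) ∞ haarAddCircle}
  zero_mem' := MemLp.ae_eq (Lp.coeFn_zero ℂ 2 haarAddCircle).symm MemLp.zero
  add_mem' {f g} hf hg := MemLp.ae_eq (Lp.coeFn_add (f : L2) g).symm (MemLp.add hf hg)
  smul_mem' c f hf := MemLp.ae_eq (Lp.coeFn_smul c (f : L2)).symm (MemLp.const_smul hf c)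

theorem kernel_mem_boundedPart {w : ℂ} (hw : ‖w‖ < 1) : kernel hθ w ∈ boundedPart θ := by
  have hinv : MemLp (fun x : UnitAddCircle => (1 - conj w * fourier 1 x)⁻¹) ∞ haarAddCircle :=
    (BoundedContinuousFunction.mkOfCompact ⟨_, continuous_inv_kernel hw⟩).memLp_top
  have hnum : MemLp (fun x => 1 - conj (diskValue θ w) * θ x) ∞ haarAddCircle :=
    (memLp_const 1).sub (hθ.memLp_top.const_mul _)
  rw [kernel, dif_pos hw]
  exact MemLp.ae_eq (memLp_kernelFun θ hw).coeFn_toLp.symm (hinv.mul' hnum)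

include hθ in
theorem dense_boundedPart : Dense (boundedPart θ : Set (K θ)) := by
  rw [Submodule.dense_iff_topologicalClosure_eq_top, Submodule.topologicalClosure_eq_top_iff,
    Submodule.eq_bot_iff]
  intro f hf
  have hzero : ∀ᶠ w : ℂ in 𝓝 0,
      HasSum (fun n : ℕ => w ^ n • fourierCoeff (f : L2) n) 0 := by
    filter_upwards [Metric.ball_mem_nhds (0 : ℂ) one_pos] with w hw
    rw [mem_ball_zero_iff] at hw
    have hval : diskValue (f : L2) w = 0 := by
      rw [← inner_kernel hθ f hw]
      exact (Submodule.mem_orthogonal _ _).1 hf _ (kernel_mem_boundedPart hθ hw)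
    simpa only [hval, smul_eq_mul, mul_comm] using hasSum_diskValue (f : L2) hw
  refine Subtype.ext (eq_zero_of_mem_H2 f.2.1 fun n => ?_)
  have h := iteratedDeriv_zero_eq_of_hasSum (g := fun _ => (0 : ℂ)) hzero n
  rwa [iteratedDeriv_fun_const_zero, eq_comm, smul_eq_zero_iff_right
    (Nat.cast_ne_zero.2 n.factorial_ne_zero)] at h

end Kernel

section ToeplitzForm

variable {θ : L2} (hθ : IsInner θ) (A : K θ →L[ℂ] K θ)

theorem mulBounded_fourierLp_zero {f : L2} (hf : MemLp f ∞ haarAddCircle) :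
    mulBounded hf (fourierLp 2 0) = f := by
  refine Lp.ext ?_
  filter_upwards [coeFn_mulBounded hf (fourierLp 2 0), coeFn_fourierLp (T := 1) 2 0] with x hmul h0
  rw [hmul, h0, fourier_zero, mul_one]

/-- The bilinear form on `K θ` attached to an operator by means of the conjugation. For a truncated
Toeplitz operator with symbol `φ` it is `p, q ↦ ∫ conj (φ θ) z p q`. -/
def conjForm : LinearMap.BilinForm ℂ (K θ) :=
  (innerₛₗ ℂ).comp ((A : K θ →ₗ[ℂ] K θ).comp (modelConj hθ : K θ →ₗ⋆[ℂ] K θ))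

theorem conjForm_apply (p q : K θ) : conjForm hθ A p q = ⟪A (modelConj hθ p), q⟫_ℂ := rfl

include hθ in
theorem memLp_top_adjoint_S {f : K θ} (hf : MemLp (f : L2) ∞ haarAddCircle) :
    MemLp (((S θ)†) f : L2) ∞ haarAddCircle := by
  have hbdd : MemLp (fun x => (f : L2) x - fourierCoeff (f : L2) 0 * fourier 0 x) ∞
      haarAddCircle := hf.sub ((memLp_top_fourier 0).const_mul _)
  refine hbdd.congr_norm (Lp.aestronglyMeasurable _) ?_
  filter_upwards [coeFn_Mz (((S θ)†) f : L2),
    Lp.coeFn_sub (f : L2) (fourierCoeff (f : L2) 0 • fourierLp 2 0),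
    Lp.coeFn_smul (fourierCoeff (f : L2) 0) (fourierLp 2 0 : L2), coeFn_fourierLp (T := 1) 2 0]
    with x hMz hsub hsmul h0
  calc ‖(f : L2) x - fourierCoeff (f : L2) 0 * fourier 0 x‖
      = ‖fourier 1 x * (((S θ)†) f : L2) x‖ := by
        rw [← hMz, Mz_adjoint_S hθ, hsub, Pi.sub_apply, hsmul, Pi.smul_apply, h0, smul_eq_mul]
    _ = ‖(((S θ)†) f : L2) x‖ := by rw [norm_mul, norm_fourier_apply, one_mul]

variable {A} {φ : L2}
  (hφ : ∀ (f : K θ) (hf : MemLp (f : L2) ∞ haarAddCircle), A f =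
    P θ ((hf.mul' (Lp.memLp φ) : MemLp (fun x => φ x * (f : L2) x) 2 haarAddCircle).toLp))
include hφ

theorem conjForm_apply_of_memLp_top {p q : K θ} (hp : MemLp (p : L2) ∞ haarAddCircle)
    (hq : MemLp (q : L2) ∞ haarAddCircle) :
    conjForm hθ A p q = ⟪mulBounded hθ.memLp_top φ, mulBounded hq (Mz (p : L2))⟫_ℂ := by
  have hC := memLp_top_modelConj hθ hp
  rw [conjForm_apply, hφ _ hC]
  refine (Submodule.inner_orthogonalProjectionOnto_eq_of_mem_right q _).trans ?_
  rw [L2.inner_def, L2.inner_def]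
  refine integral_congr_ae ?_
  filter_upwards [(hC.mul' (Lp.memLp φ) :
      MemLp (fun x => φ x * (modelConj hθ p : L2) x) 2 haarAddCircle).coeFn_toLp,
    coeFn_modelConj hθ p, coeFn_mulBounded hθ.memLp_top φ, coeFn_mulBounded hq (Mz (p : L2)),
    coeFn_Mz (p : L2)] with x hprod hconj hθφ hmul hz
  rw [hprod, hconj, hθφ, hmul, hz]
  simp only [RCLike.inner_apply, map_mul, Complex.conj_conj]
  ring

theorem conjForm_comm_of_memLp_top {p q : K θ} (hp : MemLp (p : L2) ∞ haarAddCircle)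
    (hq : MemLp (q : L2) ∞ haarAddCircle) : conjForm hθ A p q = conjForm hθ A q p := by
  rw [conjForm_apply_of_memLp_top hθ hφ hp hq, conjForm_apply_of_memLp_top hθ hφ hq hp,
    Mz_eq_mulBounded, mulBounded_comm, mulBounded_coe_comm hq hp, ← mulBounded_comm]

theorem conjForm_comm (p q : K θ) : conjForm hθ A p q = conjForm hθ A q p := by
  have hext : (fun x : K θ × K θ => ⟪A (modelConj hθ x.1), x.2⟫_ℂ) =
      fun x => ⟪A (modelConj hθ x.2), x.1⟫_ℂ :=
    Continuous.ext_on ((dense_boundedPart hθ).prod (dense_boundedPart hθ)) (by fun_prop)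
      (by fun_prop) fun x hx => conjForm_comm_of_memLp_top hθ hφ hx.1 hx.2
  exact congrFun hext (p, q)

theorem conjForm_adjoint_S_of_memLp_top {p q : K θ} (hp : MemLp (p : L2) ∞ haarAddCircle)
    (hq : MemLp (q : L2) ∞ haarAddCircle) :
    conjForm hθ A (((S θ)†) p) q + ⟪kernel hθ 0, p⟫_ℂ * ⟪mulBounded hθ.memLp_top φ, q⟫_ℂ =
      ⟪mulBounded hθ.memLp_top φ, mulBounded hp q⟫_ℂ := by
  rw [conjForm_apply_of_memLp_top hθ hφ (memLp_top_adjoint_S hθ hp) hq, Mz_adjoint_S hθ,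
    inner_kernel_zero hθ, map_sub, map_smul, mulBounded_fourierLp_zero, inner_sub_right,
    inner_smul_right, sub_add_cancel, mulBounded_coe_comm hq hp]

theorem conjForm_adjoint_S_comm (p q : K θ) :
    conjForm hθ A (((S θ)†) p) q + ⟪kernel hθ 0, p⟫_ℂ * ⟪mulBounded hθ.memLp_top φ, q⟫_ℂ =
      conjForm hθ A p (((S θ)†) q) +
        ⟪kernel hθ 0, q⟫_ℂ * ⟪mulBounded hθ.memLp_top φ, p⟫_ℂ := by
  have hext : (fun x : K θ × K θ => ⟪A (modelConj hθ (((S θ)†) x.1)), x.2⟫_ℂ +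
        ⟪kernel hθ 0, x.1⟫_ℂ * ⟪mulBounded hθ.memLp_top φ, x.2⟫_ℂ) =
      fun x => ⟪A (modelConj hθ x.1), ((S θ)†) x.2⟫_ℂ +
        ⟪kernel hθ 0, x.2⟫_ℂ * ⟪mulBounded hθ.memLp_top φ, x.1⟫_ℂ :=
    Continuous.ext_on ((dense_boundedPart hθ).prod (dense_boundedPart hθ)) (by fun_prop)
      (by fun_prop) fun x hx => calc
        _ = ⟪mulBounded hθ.memLp_top φ, mulBounded hx.1 x.2⟫_ℂ :=
          conjForm_adjoint_S_of_memLp_top hθ hφ hx.1 hx.2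
        _ = ⟪mulBounded hθ.memLp_top φ, mulBounded hx.2 x.1⟫_ℂ := by
          rw [mulBounded_coe_comm hx.1 hx.2]
        _ = _ := by
          rw [← conjForm_adjoint_S_of_memLp_top hθ hφ hx.2 hx.1, conjForm_comm hθ hφ,
            conjForm_apply]
  exact congrFun hext (p, q)

end ToeplitzForm

section Range

variable {θ : L2} (hθ : IsInner θ) {A : K θ →L[ℂ] K θ}

theorem isHankelForm_conjForm (hA : IsTruncatedToeplitz θ A) :
    IsHankelForm (conjForm hθ A) (innerₛₗ ℂ (kernel hθ 0)) ((S θ)†).toLinearMap := by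
  obtain ⟨φ, hφ⟩ := hA
  refine ⟨conjForm_comm hθ hφ, fun p q hp hq => ?_⟩
  have hshift := conjForm_adjoint_S_comm hθ hφ p q
  rw [innerₛₗ_apply_apply] at hp hq
  rwa [hp, hq, zero_mul, zero_mul, add_zero, add_zero] at hshift

theorem mem_ker_conjForm_iff (hA : IsTruncatedToeplitz θ A) {f : K θ} :
    f ∈ LinearMap.ker (conjForm hθ A) ↔ f ∈ (closureRange A)ᗮ := by
  have hsymm := (isHankelForm_conjForm hθ hA).symm
  rw [LinearMap.mem_ker, closureRange, Submodule.orthogonal_closure, Submodule.mem_orthogonal]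
  refine ⟨?_, fun h => LinearMap.ext fun q => (hsymm f q).trans (h _ ⟨_, rfl⟩)⟩
  rintro h _ ⟨g, rfl⟩
  calc ⟪A g, f⟫_ℂ = conjForm hθ A (modelConj hθ g) f := by
        rw [conjForm_apply, modelConj_modelConj]
    _ = conjForm hθ A f (modelConj hθ g) := hsymm _ _
    _ = 0 := by rw [h, LinearMap.zero_apply]

theorem inner_kernel_zero_pow_adjoint_S (f : K θ) (n : ℕ) :
    innerₛₗ ℂ (kernel hθ 0) ((((S θ)†).toLinearMap ^ n) f) = fourierCoeff (f : L2) n := by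
  induction n generalizing f with
  | zero => exact inner_kernel_zero hθ f
  | succ n ih =>
    rw [pow_succ, Module.End.mul_apply, ih]
    exact fourierCoeff_adjoint_S hθ f n

theorem inner_dbarKernel_zero (f : K θ) (n : ℕ) :
    ⟪dbarKernel hθ n 0, f⟫_ℂ = n.factorial * fourierCoeff (f : L2) n := by
  rw [dbarKernel_zero, ← inner_pow_S_kernel_zero hθ]
  exact (inner_smul_left _ f (n.factorial : ℂ)).trans (by rw [Complex.conj_natCast])

theorem inner_dbarKernel_zero_eq_zero_iff (f : K θ) (n : ℕ) :
    ⟪dbarKernel hθ n 0, f⟫_ℂ = 0 ↔ fourierCoeff (f : L2) n = 0 := by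
  rw [inner_dbarKernel_zero, mul_eq_zero_iff_left (Nat.cast_ne_zero.2 n.factorial_ne_zero)]

theorem dbarKernel_zero_mem_closureRange_iff (n : ℕ) :
    dbarKernel hθ n 0 ∈ closureRange A ↔
      ∀ f ∈ (closureRange A)ᗮ, fourierCoeff (f : L2) n = 0 :=
  (mem_iff_forall_orthogonal (Submodule.isClosed_topologicalClosure _)).trans <|
    forall₂_congr fun f _ => inner_dbarKernel_zero_eq_zero_iff hθ f n

theorem exists_dbarKernel_zero_notMem (hR : closureRange A ≠ ⊤) :
    ∃ n, dbarKernel hθ n 0 ∉ closureRange A := by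
  contrapose! hR
  rw [closureRange, Submodule.topologicalClosure_eq_top_iff, ← Submodule.orthogonal_closure,
    Submodule.eq_bot_iff]
  exact fun f hf => Subtype.ext <| eq_zero_of_mem_H2 f.2.1 fun n =>
    (dbarKernel_zero_mem_closureRange_iff hθ n).1 (hR n) f hf

theorem adjoint_S_mem_closureRange_orthogonal (hA : IsTruncatedToeplitz θ A) {n : ℕ}
    (hlt : ∀ j < n, dbarKernel hθ j 0 ∈ closureRange A)
    (hn : dbarKernel hθ n 0 ∉ closureRange A) {f : K θ} (hf : f ∈ (closureRange A)ᗮ)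
    (hfn : ⟪dbarKernel hθ n 0, f⟫_ℂ = 0) : ((S θ)†) f ∈ (closureRange A)ᗮ := by
  have hzero (g : K θ) (hg : g ∈ (closureRange A)ᗮ) (j : ℕ) (hj : j < n) :
      innerₛₗ ℂ (kernel hθ 0) ((((S θ)†).toLinearMap ^ j) g) = 0 := by
    rw [inner_kernel_zero_pow_adjoint_S]
    exact (dbarKernel_zero_mem_closureRange_iff hθ j).1 (hlt j hj) g hg
  obtain ⟨h, hh, hhn⟩ : ∃ h ∈ (closureRange A)ᗮ, fourierCoeff (h : L2) n ≠ 0 := by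
    simpa only [dbarKernel_zero_mem_closureRange_iff, not_forall, exists_prop] using hn
  rw [← mem_ker_conjForm_iff hθ hA] at hf hh ⊢
  refine (isHankelForm_conjForm hθ hA).shift_mem_ker hf hh (fun j hj => ?_)
    (hzero h ((mem_ker_conjForm_iff hθ hA).1 hh)) (by rwa [inner_kernel_zero_pow_adjoint_S])
  rcases hj.lt_or_eq with hj | rfl
  · exact hzero f ((mem_ker_conjForm_iff hθ hA).1 hf) j hj
  · rwa [inner_kernel_zero_pow_adjoint_S, ← inner_dbarKernel_zero_eq_zero_iff]

end Range

end TruncatedToeplitz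

end

theorem mainTheorem5 (θ : L2) (hθ : IsInner θ) (A : K θ →L[ℂ] K θ)
    (hA : IsTruncatedToeplitz θ A) (hR : closureRange A ≠ ⊤) :
    ∃ n : ℕ,
      IsGreatest {m : ℕ | ∀ j < m, dbarKernel hθ j 0 ∈ closureRange A} n ∧
      Disjoint (closureRange A) (Submodule.span ℂ {dbarKernel hθ n 0}) ∧
      (closureRange A).map (S θ : K θ →ₗ[ℂ] K θ) ≤
        closureRange A ⊔ Submodule.span ℂ {dbarKernel hθ n 0} := by
  obtain ⟨n, hn, hnR⟩ := exists_isGreatest_forall_lt (exists_dbarKernel_zero_notMem hθ hR)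
  exact ⟨n, hn, Submodule.disjoint_span_singleton_of_notMem hnR,
    map_le_sup_span_of_adjoint_mem (Submodule.isClosed_topologicalClosure _) fun f hf hfn =>
      adjoint_S_mem_closureRange_orthogonal hθ hA hn.1 hnR hf hfn⟩
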